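/- Let $(X,d)$ be a compact metric space, $f:X\to X$ a homeomorphism and $\varphi:X\to\mathbb R$ continuous. Equip $X\times X$ with the metric $\max\{d(x,x'),d(y,y')\}$, the homeomorphism $(f\times f)(x,y)=(f(x),f(y))$, and the potential $\Phi(x,y)=\varphi(x)+\varphi(y)$. For $\varepsilon>0$ let $\Gamma_\varepsilon(x)=\{y : d(f^n x,f^n y)\le\varepsilon\text{ for all }n\in\mathbb Z\}$ and let $\mathrm{NE}(\varepsilon;f)=\{x : \Gamma_\varepsilon(x)\ne\{x\}\}$ be the non-expansive set at scale $\varepsilon$. For an $f$-invariant Borel probability measure $\mu$ put $P_\mu(\varphi)=h_\mu(f)+\int\varphi\,d\mu$, where $h_\mu(f)$ is the Kolmogorov--Sinai entropy. The pressure of obstructions to expansivity is $$P_{\exp}^{\perp}(\varphi)=\lim_{\varepsilon\downarrow0}\ \sup\{P_\mu(\varphi) : \mu\ f\text{-invariant Borel probability measure},\ \mu(\mathrm{NE}(\varepsilon;f))=1\}\in[-\infty,\infty]$$ (with $\sup\emptyset=-\infty$). The topological pressure is $$P(\varphi)=\lim_{\varepsilon\downarrow0}\limsup_{n\to\infty}\frac1n\log\sup_E\sum_{x\in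 E}\exp\Big(\sum_{i=0}^{n-1}\varphi(f^i x)\Big)\in[-\infty,\infty],$$ where $E$ runs over the $(n,\varepsilon)$-separated subsets of $X$, i.e. those in which any two distinct points $x,y$ satisfy $d(f^i x,f^i y)\ge\varepsilon$ for some $0\le i<n$. The quantities $\mathrm{NE}(\varepsilon;f\times f)$, $P_{\exp}^{\perp}(\Phi)$ and $P(\Phi)$ are defined in the same way for the system $(X\times X,f\times f,\Phi)$. Then: 1. For every $\varepsilon>0$, $\ \mathrm{NE}(\varepsilon;f\times f)=\big(X\times\mathrm{NE}(\varepsilon;f)\big)\cup\big(\mathrm{NE}(\varepsilon;f)\times X\big)$. 2. If $P_{\exp}^{\perp}(\varphi)<P(\varphi)$, then $P_{\exp}^{\perp}(\Phi)<P(\Phi)$. -/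

import Mathlib

open Set Filter Topology MeasureTheory

noncomputable section

namespace PressureGap

/-! ### Non-expansive points -/

section Expansivity

variable {X : Type*} [MetricSpace X]

/-- `Γ_ε(x)`: the points whose full (two-sided) orbit stays within `ε` of the orbit of `x`. -/
def shadow (f : X ≃ₜ X) (ε : ℝ) (x : X) : Set X :=
  {y | ∀ n : ℤ, dist ((f ^ n) x) ((f ^ n) y) ≤ ε}

/-- `NE(ε; f)`: the non-expansive set at scale `ε`. -/
def nonExpansive (f : X ≃ₜ X) (ε : ℝ) : Set X :=
  {x | shadow f ε x ≠ {x}}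

end Expansivity

/-! ### Measure-theoretic entropy and pressure

A finite measurable partition into `k` labelled (possibly empty) pieces is a measurable map
`ξ : X → Fin k`, whose pieces are its fibres. -/

section Entropy

variable {X : Type*} [MeasurableSpace X]

/-- The Shannon entropy `- ∑ μ(A) log μ(A)` of the partition of `X` into the fibres of `ξ`. -/
def partitionEntropy {ι : Type*} [Fintype ι] (μ : Measure X) (ξ : X → ι) : ℝ :=
  ∑ a, Real.negMulLog (μ.real (ξ ⁻¹' {a}))

/-- The join `⋁_{i<n} f⁻ⁱ ξ`: two points are in the same piece iff `ξ` gives their first `n`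
iterates the same labels. -/
def itinerary {ι : Type*} (f : X → X) (ξ : X → ι) (n : ℕ) : X → (Fin n → ι) :=
  fun x i => ξ (f^[i] x)

/-- `h_μ(ξ; f) = lim (1/n) H_μ(⋁_{i<n} f⁻ⁱ ξ)`. For invariant `μ` the sequence converges by
subadditivity, so that the upper limit is the limit. -/
def entropyOfPartition {k : ℕ} (f : X → X) (μ : Measure X) (ξ : X → Fin k) : EReal :=
  limsup (fun n : ℕ => ((partitionEntropy μ (itinerary f ξ n) / n : ℝ) : EReal)) atTop

/-- The Kolmogorov-Sinai entropy `h_μ(f)`, in `[0, ∞]` for invariant `μ`. -/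
def measureEntropy (f : X → X) (μ : Measure X) : EReal :=
  ⨆ (k : ℕ) (ξ : X → Fin k) (_ : Measurable ξ), entropyOfPartition f μ ξ

/-- `P_μ(φ) = h_μ(f) + ∫ φ dμ`. -/
def measurePressure (f : X → X) (φ : X → ℝ) (μ : Measure X) : EReal :=
  measureEntropy f μ + ((∫ x, φ x ∂μ : ℝ) : EReal)

end Entropy

/-! ### Pressure of obstructions to expansivity -/

section Obstruction

variable {X : Type*} [MetricSpace X] [MeasurableSpace X]

/-- `sup {P_μ(φ) | μ an invariant Borel probability measure with μ(NE(ε; f)) = 1}`,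
with `sup ∅ = -∞`. -/
def obstructionPressureAt (f : X ≃ₜ X) (φ : X → ℝ) (ε : ℝ) : EReal :=
  sSup {p | ∃ μ : Measure X, IsProbabilityMeasure μ ∧ MeasurePreserving f μ μ ∧
    μ (nonExpansive f ε) = 1 ∧ p = measurePressure f φ μ}

/-- `P_exp^⊥(φ)`: the limit as `ε ↓ 0` of `obstructionPressureAt f φ ε`. This quantity is monotone
in `ε`, so the limit is an infimum; see `tendsto_obstructionPressureAt`. -/
def obstructionPressure (f : X ≃ₜ X) (φ : X → ℝ) : EReal :=
  ⨅ (ε : ℝ) (_ : 0 < ε), obstructionPressureAt f φ ε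

end Obstruction

/-! ### Topological pressure -/

section Topological

variable {X : Type*} [MetricSpace X]

/-- `E` is `(n, ε)`-separated: any two distinct points of `E` are at distance at least `ε` at some
time `0 ≤ i < n`. -/
def IsDynSeparated (f : X → X) (n : ℕ) (ε : ℝ) (E : Set X) : Prop :=
  ∀ x ∈ E, ∀ y ∈ E, x ≠ y → ∃ i < n, ε ≤ dist (f^[i] x) (f^[i] y)

/-- `Λ_n(φ, ε)`: the supremum of `∑_{x ∈ E} exp (∑_{i<n} φ(fⁱ x))` over the `(n, ε)`-separated
sets `E`. On a compact space these sets are finite. -/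
def partitionSum (f : X → X) (φ : X → ℝ) (ε : ℝ) (n : ℕ) : ENNReal :=
  ⨆ (E : Finset X) (_ : IsDynSeparated f n ε (E : Set X)),
    ENNReal.ofReal (∑ x ∈ E, Real.exp (birkhoffSum f φ n x))

/-- `P(φ, ε) = limsup (1/n) log Λ_n(φ, ε)`. -/
def topPressureAt (f : X → X) (φ : X → ℝ) (ε : ℝ) : EReal :=
  limsup (fun n : ℕ => ENNReal.log (partitionSum f φ ε n) / (n : EReal)) atTop

/-- The topological pressure `P(φ)`: the limit as `ε ↓ 0` of `topPressureAt f φ ε`. This quantity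
is antitone in `ε`, so the limit is a supremum; see `tendsto_topPressureAt`. -/
def topPressure (f : X → X) (φ : X → ℝ) : EReal :=
  ⨆ (ε : ℝ) (_ : 0 < ε), topPressureAt f φ ε

end Topological

/-- The potential `Φ(x, y) = φ(x) + φ(y)` on `X × X`. -/
def sumPotential {X : Type*} (φ : X → ℝ) : X × X → ℝ :=
  fun z => φ z.1 + φ z.2

/-! ### The two limits `ε ↓ 0` exist -/

section Limits

variable {X : Type*} [MetricSpace X]

theorem nonExpansive_mono (f : X ≃ₜ X) {ε δ : ℝ} (hε : 0 < ε) (h : ε ≤ δ) :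
    nonExpansive f ε ⊆ nonExpansive f δ := by
  intro x hx hδ
  refine hx (Subset.antisymm ?_ ?_)
  · intro y hy
    rw [← hδ]
    exact fun n => (hy n).trans h
  · rintro y rfl n
    simpa using hε.le

theorem obstructionPressureAt_mono [MeasurableSpace X] (f : X ≃ₜ X) (φ : X → ℝ) {ε δ : ℝ}
    (hε : 0 < ε) (h : ε ≤ δ) :
    obstructionPressureAt f φ ε ≤ obstructionPressureAt f φ δ := by
  apply sSup_le_sSup
  rintro p ⟨μ, hμ, hf, h1, rfl⟩
  refine ⟨μ, hμ, hf, le_antisymm prob_le_one ?_, rfl⟩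
  rw [← h1]
  exact measure_mono (nonExpansive_mono f hε h)

theorem tendsto_obstructionPressureAt [MeasurableSpace X] (f : X ≃ₜ X) (φ : X → ℝ) :
    Tendsto (obstructionPressureAt f φ) (𝓝[>] 0) (𝓝 (obstructionPressure f φ)) := by
  rw [tendsto_order]
  constructor
  · intro a ha
    filter_upwards [self_mem_nhdsWithin] with ε hε
    exact ha.trans_le (iInf₂_le ε hε)
  · intro a ha
    obtain ⟨δ, hδ, h⟩ : ∃ δ : ℝ, ∃ _ : 0 < δ, obstructionPressureAt f φ δ < a := by
      simpa only [obstructionPressure, iInf_lt_iff] using ha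
    filter_upwards [Ioc_mem_nhdsGT hδ] with ε hε
    exact (obstructionPressureAt_mono f φ hε.1 hε.2).trans_lt h

theorem partitionSum_anti (f : X → X) (φ : X → ℝ) {ε δ : ℝ} (h : ε ≤ δ) (n : ℕ) :
    partitionSum f φ δ n ≤ partitionSum f φ ε n := by
  refine iSup_mono fun E => iSup_le fun hE => ?_
  refine le_iSup_of_le (fun x hx y hy hxy => ?_) le_rfl
  obtain ⟨i, hi, hd⟩ := hE x hx y hy hxy
  exact ⟨i, hi, h.trans hd⟩

theorem topPressureAt_anti (f : X → X) (φ : X → ℝ) : Antitone (topPressureAt f φ) := by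
  intro ε δ h
  refine limsup_le_limsup (Eventually.of_forall fun n => ?_)
  exact EReal.div_le_div_right_of_nonneg (by positivity)
    (ENNReal.log_monotone (partitionSum_anti f φ h n))

theorem tendsto_topPressureAt (f : X → X) (φ : X → ℝ) :
    Tendsto (topPressureAt f φ) (𝓝[>] 0) (𝓝 (topPressure f φ)) := by
  rw [tendsto_order]
  constructor
  · intro a ha
    obtain ⟨δ, hδ, h⟩ : ∃ δ : ℝ, ∃ _ : 0 < δ, a < topPressureAt f φ δ := by
      simpa only [topPressure, lt_iSup_iff] using ha
    filter_upwards [Ioc_mem_nhdsGT hδ] with ε hε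
    exact h.trans_le (topPressureAt_anti f φ hε.2)
  · intro a ha
    filter_upwards [self_mem_nhdsWithin] with ε hε
    exact (le_iSup₂ (f := fun (ε : ℝ) (_ : 0 < ε) => topPressureAt f φ ε) ε hε).trans_lt ha

end Limits

end PressureGap

end

/-!
For the sup metric on `X × X` the shadow of `(x, y)` is the product of the shadows of `x` and `y`;
this gives the formula for `NE(ε; f × f)`.

Suppose `P_exp^⊥(φ) < P(φ)`, and fix a scale `ε` and a real `a` with
`obstructionPressureAt f φ ε < a < P(φ)`. Let `ν` be an invariant measure on the product with
`ν(NE(ε; f × f)) = 1`. The sets `NE(ε) × X` and `X × NE(ε)` are invariant, so by splitting `ν`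
along `NE(ε) × X` (`measurePressure_le_of_cond`) one may assume that `ν` is carried by one of them.
One marginal of `ν` is then carried by `NE(ε)` and has pressure at most `a`. If `M` bounds the
pressure of every invariant measure on `X`, subadditivity of entropy over the marginals
(`measurePressure_prod_le`) gives `P_ν(Φ) ≤ M + a`. Since products of separated sets are separated,
`2 P(φ) ≤ P(Φ)` (`add_self_le_topPressure_prodCongr`), so it remains to find `M` with
`M + a < 2 P(φ)`.

* If `P(φ)` is finite, `M = P(φ)` works, by the easy half of the variational principle
  (`measurePressure_le_of_topPressure_le`).
* If `P(φ) = ∞`, any finite `M` works. Measures carried by `NE(ε)` have pressure at most `a`, and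
  for measures that do not charge `NE(ε)` every finite partition with pieces of diameter less than
  `ε` is a generator, which bounds their entropy uniformly
  (`exists_measurePressure_le_of_nonExpansive_null`).

The three entropy bounds (variational inequality, marginals, generators) have a common proof. Given a
partition `η`, Lusin's theorem provides a compact set `G` of almost full measure on which `η` is
uniformly locally constant. If a code `c` of the orbit segment of length `n` determines its points up
to a small error, then `c` determines the `η`-labels of the iterates that lie in `G`, and the other
labels are recorded by the partition `residual η G`, whose entropy is small. Hence
`H(⋁_{i<n} f⁻ⁱ η) ≤ n H(residual η G) + H(c)` (`partitionEntropy_itinerary_le_residual`). The code is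
respectively the nearby point of a maximal `(n, ε)`-separated set, a pair of itineraries in the two
factors, and an itinerary in a partition of small diameter. This argument needs neither conditional
entropy nor powers of the map.
-/

namespace PressureGap

/-! ### Entropy of finite probability vectors -/

section Vectors

variable {ι κ : Type*}

theorem negMulLog_sum_le (s : Finset ι) (p : ι → ℝ) (hp : ∀ i, 0 ≤ p i) :
    Real.negMulLog (∑ i ∈ s, p i) ≤ ∑ i ∈ s, Real.negMulLog (p i) := by
  simp only [Real.negMulLog, neg_mul, Finset.sum_mul, Finset.sum_neg_distrib, neg_le_neg_iff]
  refine Finset.sum_le_sum fun i hi => ?_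
  rcases (hp i).eq_or_lt with h | h
  · simp [← h]
  · exact mul_le_mul_of_nonneg_left
      (Real.log_le_log h (Finset.single_le_sum (fun j _ => hp j) hi)) h.le

theorem negMulLog_add_mul_log_le {p q : ℝ} (hp : 0 ≤ p) (hq : 0 ≤ q) (h : q = 0 → p = 0) :
    Real.negMulLog p + p * Real.log q ≤ q - p := by
  rcases hp.eq_or_lt with h0 | h0
  · simp [← h0, hq]
  · have hq' : 0 < q := hq.lt_of_ne fun e => h0.ne' (h e.symm)
    have := mul_le_mul_of_nonneg_left (Real.log_le_sub_one_of_pos (div_pos hq' h0)) h0.le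
    rw [Real.log_div hq'.ne' h0.ne', mul_sub, mul_sub, mul_div_cancel₀ _ h0.ne'] at this
    rw [Real.negMulLog]
    linarith

variable [Fintype ι] [Fintype κ]

/-- Gibbs' inequality: the relative entropy of `p` with respect to `q` is nonnegative. -/
theorem sum_negMulLog_add_mul_log_le (p q : ι → ℝ) (hp : ∀ i, 0 ≤ p i) (hq : ∀ i, 0 ≤ q i)
    (h : ∀ i, q i = 0 → p i = 0) (hpq : ∑ i, q i = ∑ i, p i) :
    ∑ i, Real.negMulLog (p i) + ∑ i, p i * Real.log (q i) ≤ 0 := by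
  rw [← Finset.sum_add_distrib]
  calc _ ≤ ∑ i, (q i - p i) :=
        Finset.sum_le_sum fun i _ => negMulLog_add_mul_log_le (hp i) (hq i) (h i)
    _ = 0 := by rw [Finset.sum_sub_distrib, hpq, sub_self]

/-- The finite variational principle: entropy plus energy is at most the log of the partition
function. -/
theorem sum_negMulLog_add_sum_mul_le [Nonempty ι] (p s : ι → ℝ) (hp : ∀ i, 0 ≤ p i)
    (h1 : ∑ i, p i = 1) :
    ∑ i, Real.negMulLog (p i) + ∑ i, p i * s i ≤ Real.log (∑ i, Real.exp (s i)) := by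
  set Z := ∑ i, Real.exp (s i)
  have hZ : 0 < Z := Finset.sum_pos (fun i _ => Real.exp_pos _) Finset.univ_nonempty
  have := sum_negMulLog_add_mul_log_le p (fun i => Real.exp (s i) / Z) hp
    (fun i => by positivity) (fun i hi => absurd hi (by positivity))
    (by rw [← Finset.sum_div, h1, div_self hZ.ne'])
  simp only [Real.log_div (Real.exp_ne_zero _) hZ.ne', Real.log_exp, mul_sub,
    Finset.sum_sub_distrib, ← Finset.sum_mul, h1] at this
  linarith

theorem sum_negMulLog_prod_le (p : ι × κ → ℝ) (hp : ∀ i, 0 ≤ p i) (h1 : ∑ i, p i = 1) :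
    ∑ i, Real.negMulLog (p i) ≤
      ∑ a, Real.negMulLog (∑ b, p (a, b)) + ∑ b, Real.negMulLog (∑ a, p (a, b)) := by
  have hz1 : ∀ i : ι × κ, ∑ b, p (i.1, b) = 0 → p i = 0 := fun i hi =>
    (Finset.sum_eq_zero_iff_of_nonneg fun b _ => hp (i.1, b)).1 hi i.2 (Finset.mem_univ _)
  have hz2 : ∀ i : ι × κ, ∑ a, p (a, i.2) = 0 → p i = 0 := fun i hi =>
    (Finset.sum_eq_zero_iff_of_nonneg fun a _ => hp (a, i.2)).1 hi i.1 (Finset.mem_univ _)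
  have hs1 : ∑ a, ∑ b, p (a, b) = 1 := by rw [← h1, Fintype.sum_prod_type]
  have hs2 : ∑ b, ∑ a, p (a, b) = 1 := by rw [← h1, Fintype.sum_prod_type_right]
  have key := sum_negMulLog_add_mul_log_le p
    (fun i => (∑ b, p (i.1, b)) * ∑ a, p (a, i.2)) hp
    (fun i => mul_nonneg (Finset.sum_nonneg fun _ _ => hp _) (Finset.sum_nonneg fun _ _ => hp _))
    (fun i hi => (mul_eq_zero.1 hi).elim (hz1 i) (hz2 i))
    (by
      rw [Fintype.sum_prod_type]
      simp only [← Finset.mul_sum, hs1, hs2, h1, mul_one])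
  have e : ∀ i : ι × κ, p i * Real.log ((∑ b, p (i.1, b)) * ∑ a, p (a, i.2)) =
      p i * Real.log (∑ b, p (i.1, b)) + p i * Real.log (∑ a, p (a, i.2)) := by
    intro i
    by_cases h0 : p i = 0
    · simp [h0]
    · rw [Real.log_mul (fun h => h0 (hz1 i h)) (fun h => h0 (hz2 i h)), mul_add]
  have e1 : ∑ i : ι × κ, p i * Real.log (∑ b, p (i.1, b)) =
      - ∑ a, Real.negMulLog (∑ b, p (a, b)) := by
    rw [Fintype.sum_prod_type]
    simp [← Finset.sum_mul, Real.negMulLog]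
  have e2 : ∑ i : ι × κ, p i * Real.log (∑ a, p (a, i.2)) =
      - ∑ b, Real.negMulLog (∑ a, p (a, b)) := by
    rw [Fintype.sum_prod_type_right]
    simp [← Finset.sum_mul, Real.negMulLog]
  simp only [e, Finset.sum_add_distrib, e1, e2] at key
  linarith

end Vectors

/-! ### Entropy of partitions -/

section Partitions

variable {X ι κ τ : Type*} [MeasurableSpace X]
  [Fintype ι] [MeasurableSpace ι] [MeasurableSingletonClass ι]
  [Fintype κ] [MeasurableSpace κ] [MeasurableSingletonClass κ]
  [Fintype τ]

theorem sum_measureReal_fiber (μ : Measure X) [IsFiniteMeasure μ] {ξ : X → ι} (hξ : Measurable ξ)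
    (B : Set X) : ∑ a, μ.real (B ∩ ξ ⁻¹' {a}) = μ.real B := by
  classical
  have hU : B = ⋃ a, B ∩ ξ ⁻¹' {a} := by
    rw [← inter_iUnion, ← preimage_iUnion, iUnion_of_singleton, preimage_univ, inter_univ]
  have h2 : ∀ a, μ.real (B ∩ ξ ⁻¹' {a}) = (μ.restrict B).real (ξ ⁻¹' {a}) := fun a => by
    rw [measureReal_restrict_apply (hξ (measurableSet_singleton a)), inter_comm]
  simp only [h2]
  rw [← map_measureReal_apply hξ MeasurableSet.univ |>.trans
    (show (μ.restrict B).real (ξ ⁻¹' univ) = μ.real B by simp)]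
  simp_rw [← map_measureReal_apply hξ (measurableSet_singleton _)]
  rw [← Finset.coe_univ, sum_measureReal_singleton]

theorem sum_measureReal_fiber_eq_one (μ : Measure X) [IsProbabilityMeasure μ] {ξ : X → ι}
    (hξ : Measurable ξ) : ∑ a, μ.real (ξ ⁻¹' {a}) = 1 := by
  simpa using sum_measureReal_fiber μ hξ univ

theorem partitionEntropy_add_sum_mul_le (μ : Measure X) [IsProbabilityMeasure μ] {ξ : X → ι}
    (hξ : Measurable ξ) (s : ι → ℝ) :
    partitionEntropy μ ξ + ∑ a, μ.real (ξ ⁻¹' {a}) * s a ≤ Real.log (∑ a, Real.exp (s a)) := by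
  have : Nonempty X := nonempty_of_isProbabilityMeasure μ
  have : Nonempty ι := this.map ξ
  exact sum_negMulLog_add_sum_mul_le _ s (fun _ => measureReal_nonneg)
    (sum_measureReal_fiber_eq_one μ hξ)

theorem partitionEntropy_le_log_card (μ : Measure X) [IsProbabilityMeasure μ] {ξ : X → ι}
    (hξ : Measurable ξ) : partitionEntropy μ ξ ≤ Real.log (Fintype.card ι) := by
  simpa using partitionEntropy_add_sum_mul_le μ hξ fun _ => 0

theorem partitionEntropy_le_of_factorsThrough (μ : Measure X) [IsProbabilityMeasure μ]
    {ξ : X → τ} {ζ : X → ι} (hζ : Measurable ζ) (h : Function.FactorsThrough ξ ζ) :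
    partitionEntropy μ ξ ≤ partitionEntropy μ ζ := by
  classical
  have : Nonempty X := nonempty_of_isProbabilityMeasure μ
  have : Nonempty τ := this.map ξ
  obtain ⟨g, rfl⟩ := (Function.factorsThrough_iff ξ).1 h
  have e : ∀ a, μ.real ((g ∘ ζ) ⁻¹' {a}) =
      ∑ b ∈ Finset.univ.filter (fun b => g b = a), μ.real (ζ ⁻¹' {b}) := by
    intro a
    rw [← sum_measureReal_fiber μ hζ, Finset.sum_filter]
    refine Finset.sum_congr rfl fun b _ => ?_
    split_ifs with hb
    · congr 1
      ext x
      simp only [mem_inter_iff, mem_preimage, mem_singleton_iff, Function.comp_apply]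
      exact ⟨fun h => h.2, fun h => ⟨by rw [h, hb], h⟩⟩
    · rw [show (g ∘ ζ) ⁻¹' {a} ∩ ζ ⁻¹' {b} = ∅ from ?_, measureReal_empty]
      ext x
      simp only [mem_inter_iff, mem_preimage, mem_singleton_iff, Function.comp_apply,
        mem_empty_iff_false, iff_false, not_and]
      rintro h rfl
      exact hb h
  simp only [partitionEntropy, e]
  refine (Finset.sum_le_sum fun a _ => negMulLog_sum_le _ _ fun b => measureReal_nonneg).trans ?_
  exact (Finset.sum_fiberwise Finset.univ g fun b => Real.negMulLog (μ.real (ζ ⁻¹' {b}))).le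

theorem partitionEntropy_prod_le (μ : Measure X) [IsProbabilityMeasure μ] {α : X → ι} {β : X → κ}
    (hα : Measurable α) (hβ : Measurable β) :
    partitionEntropy μ (fun x => (α x, β x)) ≤ partitionEntropy μ α + partitionEntropy μ β := by
  have hs : ∀ i : ι × κ, (fun x => (α x, β x)) ⁻¹' {i} = α ⁻¹' {i.1} ∩ β ⁻¹' {i.2} := by
    intro i
    ext x
    simp [Prod.ext_iff]
  have h := sum_negMulLog_prod_le (fun i : ι × κ => μ.real ((fun x => (α x, β x)) ⁻¹' {i}))
    (fun _ => measureReal_nonneg) (sum_measureReal_fiber_eq_one μ (hα.prodMk hβ))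
  simp only [hs, sum_measureReal_fiber μ hβ] at h
  simp only [inter_comm (α ⁻¹' _), sum_measureReal_fiber μ hα] at h
  simpa only [partitionEntropy, hs, inter_comm (α ⁻¹' _)] using h

/-- A partition determined by two others has at most the sum of their entropies. -/
theorem partitionEntropy_le_add (μ : Measure X) [IsProbabilityMeasure μ] {ξ : X → τ}
    {α : X → ι} {β : X → κ} (hα : Measurable α) (hβ : Measurable β)
    (h : ∀ x y, α x = α y → β x = β y → ξ x = ξ y) :
    partitionEntropy μ ξ ≤ partitionEntropy μ α + partitionEntropy μ β :=
  (partitionEntropy_le_of_factorsThrough μ (hα.prodMk hβ) fun x y hxy =>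
    h x y (Prod.ext_iff.1 hxy).1 (Prod.ext_iff.1 hxy).2).trans (partitionEntropy_prod_le μ hα hβ)

theorem measurable_itinerary {σ : Type*} [MeasurableSpace σ] {T : X → X} (hT : Measurable T)
    {ξ : X → σ} (hξ : Measurable ξ) (n : ℕ) : Measurable (itinerary T ξ n) :=
  measurable_pi_lambda _ fun i => hξ.comp (hT.iterate i)

theorem partitionEntropy_comp {Y : Type*} [MeasurableSpace Y] {μ : Measure X} {ν : Measure Y}
    {T : X → Y} (hT : MeasurePreserving T μ ν) {ξ : Y → ι} (hξ : Measurable ξ) :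
    partitionEntropy μ (ξ ∘ T) = partitionEntropy ν ξ := by
  refine Finset.sum_congr rfl fun a _ => ?_
  rw [preimage_comp, hT.measureReal_preimage (hξ (measurableSet_singleton a)).nullMeasurableSet]

theorem partitionEntropy_itinerary_le {μ : Measure X} [IsProbabilityMeasure μ] {T : X → X}
    (hT : MeasurePreserving T μ μ) {ξ : X → ι} (hξ : Measurable ξ) (n : ℕ) :
    partitionEntropy μ (itinerary T ξ n) ≤ n * partitionEntropy μ ξ := by
  induction n with
  | zero =>
    simpa using partitionEntropy_le_log_card μ (measurable_itinerary hT.measurable hξ 0)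
  | succ n ih =>
    have h : partitionEntropy μ (itinerary T ξ (n + 1)) ≤
        partitionEntropy μ (itinerary T ξ n) + partitionEntropy μ (ξ ∘ T^[n]) := by
      refine partitionEntropy_le_add μ (measurable_itinerary hT.measurable hξ n)
        (hξ.comp (hT.measurable.iterate n)) fun x y h1 h2 => ?_
      funext i
      rcases Nat.lt_succ_iff_lt_or_eq.1 i.2 with hi | hi
      · exact congrFun h1 ⟨i, hi⟩
      · simpa [itinerary, hi] using h2
    rw [partitionEntropy_comp (hT.iterate n) hξ] at h
    push_cast
    linarith

end Partitions

/-! ### Bounds for the pressure of a measure -/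

section Bounds

variable {X : Type*} [MeasurableSpace X]

theorem limsup_coe_le_coe_iff (u : ℕ → ℝ) (r : ℝ) :
    limsup (fun n => (u n : EReal)) atTop ≤ (r : EReal) ↔
      ∀ δ > 0, ∀ᶠ n in atTop, u n ≤ r + δ := by
  constructor
  · intro h δ hδ
    have : (r : EReal) < ((r + δ : ℝ) : EReal) := EReal.coe_lt_coe_iff.2 (by linarith)
    filter_upwards [eventually_lt_of_limsup_lt (h.trans_lt this)] with n hn
    exact (EReal.coe_lt_coe_iff.1 hn).le
  · intro h
    by_contra! hlt
    obtain ⟨c, hc1, hc2⟩ := EReal.lt_iff_exists_real_btwn.1 hlt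
    refine hc2.not_ge (limsup_le_of_le (h := ?_))
    filter_upwards [h (c - r) (sub_pos.2 (EReal.coe_lt_coe_iff.1 hc1))] with n hn
    exact EReal.coe_le_coe_iff.2 (by linarith)

theorem measurePressure_le_coe_iff (T : X → X) (φ : X → ℝ) (μ : Measure X) (B : ℝ) :
    measurePressure T φ μ ≤ (B : EReal) ↔
      ∀ (k : ℕ) (ξ : X → Fin k), Measurable ξ → ∀ δ > 0, ∀ᶠ n : ℕ in atTop,
        partitionEntropy μ (itinerary T ξ n) / n + ∫ x, φ x ∂μ ≤ B + δ := by
  have h1 : measurePressure T φ μ ≤ (B : EReal) ↔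
      measureEntropy T μ ≤ ((B - ∫ x, φ x ∂μ : ℝ) : EReal) := by
    rw [measurePressure, EReal.coe_sub, EReal.le_sub_iff_add_le (by simp) (by simp)]
  rw [h1]
  simp only [measureEntropy, iSup_le_iff, entropyOfPartition, limsup_coe_le_coe_iff]
  refine forall_congr' fun k => forall_congr' fun ξ => forall_congr' fun _ =>
    forall_congr' fun δ => forall_congr' fun _ => eventually_congr (Eventually.of_forall fun n => ?_)
  constructor <;> intro h <;> linarith

theorem negMulLog_add_le {p q : ℝ} (hp : 0 ≤ p) (hq : 0 ≤ q) :
    Real.negMulLog (p + q) ≤ Real.negMulLog p + Real.negMulLog q := by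
  simpa using negMulLog_sum_le Finset.univ ![p, q] (by simp [Fin.forall_fin_two, hp, hq])

theorem measureReal_inter_eq_mul_cond (μ : Measure X) [IsFiniteMeasure μ] {A : Set X}
    (hA : MeasurableSet A) (B : Set X) :
    μ.real (A ∩ B) = μ.real A * (ProbabilityTheory.cond μ A).real B := by
  rw [mul_comm, measureReal_def, measureReal_def, measureReal_def, ← ENNReal.toReal_mul,
    ProbabilityTheory.cond_mul_eq_inter hA]

/-- Entropy is convex up to a bounded error under splitting the space into two pieces. -/
theorem partitionEntropy_le_cond_add {ι : Type*} [Fintype ι] [MeasurableSpace ι]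
    [MeasurableSingletonClass ι] (μ : Measure X) [IsProbabilityMeasure μ] {A : Set X}
    (hA : MeasurableSet A) (h0 : μ A ≠ 0) (h1 : μ Aᶜ ≠ 0) {ξ : X → ι} (hξ : Measurable ξ) :
    partitionEntropy μ ξ ≤ μ.real A * partitionEntropy (ProbabilityTheory.cond μ A) ξ +
      μ.real Aᶜ * partitionEntropy (ProbabilityTheory.cond μ Aᶜ) ξ + 2 := by
  have := ProbabilityTheory.cond_isProbabilityMeasure h0
  have := ProbabilityTheory.cond_isProbabilityMeasure h1
  have e : ∀ B : Set X, MeasurableSet B → IsProbabilityMeasure (ProbabilityTheory.cond μ B) →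
      ∑ a, Real.negMulLog (μ.real (B ∩ ξ ⁻¹' {a})) ≤
        μ.real B * partitionEntropy (ProbabilityTheory.cond μ B) ξ + 1 := by
    intro B hB _
    simp only [measureReal_inter_eq_mul_cond μ hB, Real.negMulLog_mul, Finset.sum_add_distrib,
      ← Finset.sum_mul, ← Finset.mul_sum,
      sum_measureReal_fiber_eq_one (ProbabilityTheory.cond μ B) hξ]
    have := Real.negMulLog_le_one_sub_self (measureReal_nonneg (μ := μ) (s := B))
    have : 0 ≤ μ.real B := measureReal_nonneg
    rw [partitionEntropy]
    linarith
  have h2 : partitionEntropy μ ξ ≤ ∑ a, Real.negMulLog (μ.real (A ∩ ξ ⁻¹' {a})) +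
      ∑ a, Real.negMulLog (μ.real (Aᶜ ∩ ξ ⁻¹' {a})) := by
    rw [← Finset.sum_add_distrib]
    refine Finset.sum_le_sum fun a _ => ?_
    rw [← measureReal_inter_add_sdiff (s := ξ ⁻¹' {a}) hA, inter_comm, sdiff_eq,
      inter_comm (ξ ⁻¹' {a}) Aᶜ]
    exact negMulLog_add_le measureReal_nonneg measureReal_nonneg
  linarith [e A hA inferInstance, e Aᶜ hA.compl inferInstance]

theorem measurePreserving_cond {μ : Measure X} [IsFiniteMeasure μ] {T : X → X}
    (hT : MeasurePreserving T μ μ) {A : Set X} (hA : MeasurableSet A) (hTA : T ⁻¹' A = A) :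
    MeasurePreserving T (ProbabilityTheory.cond μ A) (ProbabilityTheory.cond μ A) := by
  have := hT.restrict_preimage hA
  rw [hTA] at this
  exact this.smul_measure _

/-- A bound for the pressure of the two measures obtained by conditioning on a set and its
complement is a bound for the pressure of the measure. For an invariant set the conditioned measures
are invariant, and this replaces affinity of the entropy map and the ergodic decomposition. -/
theorem measurePressure_le_of_cond {μ : Measure X} [IsProbabilityMeasure μ] {T : X → X}
    (hT : Measurable T) {φ : X → ℝ} (hφ : Integrable φ μ) {A : Set X}
    (hA : MeasurableSet A) {B : ℝ}
    (h0 : μ A ≠ 0 → measurePressure T φ (ProbabilityTheory.cond μ A) ≤ B)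
    (h1 : μ Aᶜ ≠ 0 → measurePressure T φ (ProbabilityTheory.cond μ Aᶜ) ≤ B) :
    measurePressure T φ μ ≤ B := by
  have hfull : ∀ S : Set X, MeasurableSet S → μ Sᶜ = 0 → ProbabilityTheory.cond μ S = μ := by
    intro S hS h
    have h' : μ S = 1 := (prob_compl_eq_zero_iff hS).1 h
    rw [ProbabilityTheory.cond, h', inv_one, one_smul, Measure.restrict_eq_self_of_ae_mem]
    exact h
  by_cases hA0 : μ A = 0
  · rw [← hfull Aᶜ hA.compl (by rwa [compl_compl])]
    refine h1 fun h => ?_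
    exact zero_ne_one (hA0.symm.trans ((prob_compl_eq_zero_iff hA).1 h))
  by_cases hA1 : μ Aᶜ = 0
  · rw [← hfull A hA hA1]
    exact h0 hA0
  rw [measurePressure_le_coe_iff]
  intro k ξ hξ δ hδ
  have hI : ∫ x, φ x ∂μ = μ.real A * ∫ x, φ x ∂(ProbabilityTheory.cond μ A) +
      μ.real Aᶜ * ∫ x, φ x ∂(ProbabilityTheory.cond μ Aᶜ) := by
    rw [← integral_add_compl hA hφ]
    simp only [ProbabilityTheory.cond, integral_smul_measure, smul_eq_mul, ENNReal.toReal_inv]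
    rw [← measureReal_def, ← measureReal_def, ← mul_assoc, ← mul_assoc, mul_inv_cancel₀,
      mul_inv_cancel₀, one_mul, one_mul]
    · exact (measureReal_ne_zero_iff).2 hA1
    · exact (measureReal_ne_zero_iff).2 hA0
  filter_upwards [(measurePressure_le_coe_iff ..).1 (h0 hA0) k ξ hξ (δ / 2) (half_pos hδ),
    (measurePressure_le_coe_iff ..).1 (h1 hA1) k ξ hξ (δ / 2) (half_pos hδ),
    eventually_ge_atTop (Nat.ceil (4 / δ)), eventually_gt_atTop 0] with n ha hb hn hn0
  have hn0' : (0 : ℝ) < n := Nat.cast_pos.2 hn0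
  have h := partitionEntropy_le_cond_add μ hA hA0 hA1 (measurable_itinerary hT hξ n)
  have hd : (2 : ℝ) / n ≤ δ / 2 := by
    have := Nat.ceil_le.1 hn
    rw [div_le_iff₀ hδ] at this
    rw [div_le_iff₀ hn0']
    linarith
  have h' := div_le_div_of_nonneg_right h hn0'.le
  rw [add_div, add_div, mul_div_assoc, mul_div_assoc] at h'
  have ht : μ.real A + μ.real Aᶜ = 1 := by
    rw [measureReal_add_measureReal_compl hA, probReal_univ]
  have ha' := mul_le_mul_of_nonneg_left ha (measureReal_nonneg (μ := μ) (s := A))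
  have hb' := mul_le_mul_of_nonneg_left hb (measureReal_nonneg (μ := μ) (s := Aᶜ))
  have : μ.real A * (B + δ / 2) + μ.real Aᶜ * (B + δ / 2) = B + δ / 2 := by
    rw [← add_mul, ht, one_mul]
  rw [hI]
  linarith

end Bounds

/-! ### Partitions that are almost locally constant -/

section Residual

variable {X : Type*} [MeasurableSpace X] {k : ℕ}

open Classical in
/-- The partition whose pieces are the set `G` (with label `0`) and the traces on the complement of
`G` of the pieces of `η`. -/
noncomputable def residual (η : X → Fin k) (G : Set X) : X → Fin (k + 1) :=
  fun x => if x ∈ G then 0 else (η x).succ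

theorem measurable_residual {η : X → Fin k} (hη : Measurable η) {G : Set X}
    (hG : MeasurableSet G) : Measurable (residual η G) :=
  Measurable.ite hG measurable_const ((measurable_of_finite Fin.succ).comp hη)

/-- If `G` has almost full measure then the residual partition has small entropy. -/
theorem exists_partitionEntropy_residual_lt (k : ℕ) {κ : ℝ} (hκ : 0 < κ) :
    ∃ δ > 0, ∀ (μ : Measure X) [IsProbabilityMeasure μ] (η : X → Fin k) (G : Set X),
      MeasurableSet G → μ.real Gᶜ < δ → partitionEntropy μ (residual η G) < κ := by
  have hc : Continuous fun p : Fin (k + 1) → ℝ => ∑ a, Real.negMulLog (p a) := by fun_prop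
  obtain ⟨δ, hδ, h⟩ := Metric.continuous_iff.1 hc (Pi.single 0 1) κ hκ
  refine ⟨δ, hδ, fun μ _ η G hG hμ => ?_⟩
  have h0 : ∑ a, Real.negMulLog ((Pi.single 0 1 : Fin (k + 1) → ℝ) a) = 0 := by
    simp [Fin.sum_univ_succ]
  have := h (fun a => μ.real (residual η G ⁻¹' {a})) ((dist_pi_lt_iff hδ).2 fun a => ?_)
  · rw [h0, Real.dist_0_eq_abs] at this
    exact (le_abs_self _).trans_lt this
  · refine Fin.cases ?_ (fun j => ?_) a
    · have e : residual η G ⁻¹' {0} = G := by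
        ext x
        simp only [residual, mem_preimage, mem_singleton_iff]
        split_ifs with hx <;> simp [hx]
      rw [e, Pi.single_eq_same, Real.dist_eq, abs_sub_comm, abs_of_nonneg
        (sub_nonneg.2 measureReal_le_one), ← probReal_compl_eq_one_sub hG]
      exact hμ
    · rw [Pi.single_eq_of_ne (Fin.succ_ne_zero j), Real.dist_0_eq_abs,
        abs_of_nonneg measureReal_nonneg]
      refine (measureReal_mono fun x hx hxG => ?_).trans_lt hμ
      simp only [residual, mem_preimage, mem_singleton_iff, if_pos hxG] at hx
      exact Fin.succ_ne_zero j hx.symm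

/-- The entropy comparison behind every bound on Kolmogorov-Sinai entropy below. If the `η`-labels
of the iterates that lie in `G` are determined by `c`, then the entropy of the `η`-itinerary exceeds
that of `c` by at most the entropy of the residual partition per unit of time. -/
theorem partitionEntropy_itinerary_le_residual {μ : Measure X} [IsProbabilityMeasure μ]
    {T : X → X} (hT : MeasurePreserving T μ μ) {η : X → Fin k} (hη : Measurable η) {G : Set X}
    (hG : MeasurableSet G) {ι : Type*} [Fintype ι] [MeasurableSpace ι]
    [MeasurableSingletonClass ι] {c : X → ι} (hc : Measurable c) {n : ℕ}
    (h : ∀ x y, c x = c y → ∀ i < n, T^[i] x ∈ G → T^[i] y ∈ G → η (T^[i] x) = η (T^[i] y)) :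
    partitionEntropy μ (itinerary T η n) ≤
      n * partitionEntropy μ (residual η G) + partitionEntropy μ c := by
  have hr := measurable_residual hη hG
  refine (partitionEntropy_le_add μ (measurable_itinerary hT.measurable hr n) hc
    fun x y h1 h2 => ?_).trans (add_le_add_left (partitionEntropy_itinerary_le hT hr n) _)
  funext i
  have h3 : residual η G (T^[i] x) = residual η G (T^[i] y) := congrFun h1 i
  change η (T^[i] x) = η (T^[i] y)
  unfold residual at h3
  split_ifs at h3 with hx hy hy
  · exact h x y h2 i i.2 hx hy
  · exact absurd h3.symm (Fin.succ_ne_zero _)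
  · exact absurd h3 (Fin.succ_ne_zero _)
  · exact Fin.succ_injective _ h3

end Residual

section Lusin

variable {X : Type*} [MetricSpace X] [CompactSpace X] [MeasurableSpace X] [BorelSpace X] {k : ℕ}

/-- Lusin's theorem for a finite partition, with uniformity. -/
theorem exists_isCompact_locally_const (μ : Measure X) [IsFiniteMeasure μ] {η : X → Fin k}
    (hη : Measurable η) {δ : ℝ} (hδ : 0 < δ) :
    ∃ G : Set X, IsCompact G ∧ μ.real Gᶜ < δ ∧
      ∃ r > 0, ∀ x ∈ G, ∀ y ∈ G, dist x y < r → η x = η y := by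
  have hk : 0 < δ / (k + 1) := by positivity
  have hK : ∀ j : Fin k, ∃ K ⊆ η ⁻¹' {j}, IsCompact K ∧
      μ (η ⁻¹' {j} \ K) < ENNReal.ofReal (δ / (k + 1)) := fun j =>
    (hη (measurableSet_singleton j)).exists_isCompact_sdiff_lt (measure_ne_top _ _)
      (ENNReal.ofReal_pos.2 hk).ne'
  choose K hKs hKc hKμ using hK
  have hGc : IsCompact (⋃ j, K j) := isCompact_iUnion hKc
  refine ⟨⋃ j, K j, hGc, ?_, ?_⟩
  · have hsub : (⋃ j, K j)ᶜ ⊆ ⋃ j, (η ⁻¹' {j} \ K j) := fun x hx =>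
      mem_iUnion.2 ⟨η x, rfl, fun h => hx (mem_iUnion.2 ⟨_, h⟩)⟩
    calc μ.real (⋃ j, K j)ᶜ ≤ ∑ j, μ.real (η ⁻¹' {j} \ K j) :=
          (measureReal_mono hsub).trans (measureReal_iUnion_fintype_le _)
      _ ≤ ∑ _j : Fin k, δ / (k + 1) := Finset.sum_le_sum fun j _ =>
          (ENNReal.toReal_lt_of_lt_ofReal (hKμ j)).le
      _ < δ := by
          rw [Finset.sum_const, Finset.card_univ, Fintype.card_fin, nsmul_eq_mul, mul_div_assoc',
            div_lt_iff₀ (by positivity)]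
          nlinarith
  · have hcont : ContinuousOn (fun x => (η x : ℝ)) (⋃ j, K j) := by
      refine (locallyFinite_of_finite K).continuousOn_iUnion (fun j => (hKc j).isClosed) fun j => ?_
      exact continuousOn_const.congr fun x hx => by
        rw [show η x = j from hKs j hx]
    obtain ⟨r, hr, h⟩ := Metric.uniformContinuousOn_iff.1
      (hGc.uniformContinuousOn_of_continuous hcont) 1 one_pos
    refine ⟨r, hr, fun x hx y hy hxy => ?_⟩
    have := h x hx y hy hxy
    rw [Nat.dist_cast_real] at this
    by_contra hne
    exact this.not_ge (Nat.pairwise_one_le_dist fun e => hne (Fin.ext e))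

end Lusin

/-! ### Coding by finite covers -/

section Coding

theorem exists_measurable_selection {X ι : Type*} [MeasurableSpace X] [MeasurableSpace ι]
    [Fintype ι] [Nonempty ι] (U : ι → Set X) (hU : ∀ i, MeasurableSet (U i))
    (hcov : ∀ x, ∃ i, x ∈ U i) : ∃ c : X → ι, Measurable c ∧ ∀ x, x ∈ U (c x) := by
  classical
  suffices h : ∀ s : Finset ι, ∃ c : X → ι, Measurable c ∧ ∀ x, (∃ i ∈ s, x ∈ U i) → x ∈ U (c x) by
    obtain ⟨c, hc, h⟩ := h Finset.univ
    exact ⟨c, hc, fun x => h x ((hcov x).imp fun i hi => ⟨Finset.mem_univ i, hi⟩)⟩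
  intro s
  induction s using Finset.induction_on with
  | empty => exact ⟨fun _ => Classical.arbitrary ι, measurable_const, by simp⟩
  | insert a s _ ih =>
    obtain ⟨c, hc, h⟩ := ih
    refine ⟨fun x => if x ∈ U a then a else c x, Measurable.ite (hU a) measurable_const hc, ?_⟩
    rintro x ⟨i, hi, hx⟩
    by_cases hxa : x ∈ U a
    · simp [hxa]
    · simp only [hxa, if_false]
      rcases Finset.mem_insert.1 hi with rfl | hi
      · exact absurd hx hxa
      · exact h x ⟨i, hi, hx⟩

variable {X : Type*} [MetricSpace X] [CompactSpace X]

theorem exists_measurable_partition_dist_lt [Nonempty X] [MeasurableSpace X]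
    [OpensMeasurableSpace X] {ε : ℝ} (hε : 0 < ε) :
    ∃ (m : ℕ) (ξ : X → Fin m), Measurable ξ ∧ ∀ x y, ξ x = ξ y → dist x y < ε := by
  obtain ⟨t, -, ht, hcov⟩ :=
    finite_cover_balls_of_compact (isCompact_univ (X := X)) (half_pos hε)
  have := ht.fintype
  have hc : ∀ x, ∃ i : t, x ∈ Metric.ball (i : X) (ε / 2) := fun x => by
    simpa using hcov (mem_univ x)
  have : Nonempty t := (hc (Classical.arbitrary X)).nonempty
  obtain ⟨c, hcm, h⟩ := exists_measurable_selection (fun i : t => Metric.ball (i : X) (ε / 2))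
    (fun i => Metric.isOpen_ball.measurableSet) hc
  refine ⟨_, Fintype.equivFin t ∘ c, (measurable_of_finite _).comp hcm, fun x y hxy => ?_⟩
  have e : c x = c y := (Fintype.equivFin t).injective hxy
  have h1 := Metric.mem_ball.1 (h x)
  have h2 := Metric.mem_ball'.1 (h y)
  rw [e] at h1
  linarith [dist_triangle x (c y : X) y]

/-- A separated set of maximal cardinality is spanning. -/
theorem exists_isDynSeparated_spanning [Nonempty X] (T : X → X) (n : ℕ) {ε : ℝ} (hε : 0 < ε) :
    ∃ E : Finset X, IsDynSeparated T n ε (E : Set X) ∧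
      ∀ x, ∃ e ∈ E, ∀ i < n, dist (T^[i] x) (T^[i] e) < ε := by
  classical
  borelize X
  obtain ⟨m, ξ, -, hξ⟩ := exists_measurable_partition_dist_lt (X := X) hε
  -- itineraries in a partition of diameter less than `ε` separate the points of a separated set,
  -- which bounds its cardinality
  let S : Set ℕ := {c | ∃ E : Finset X, IsDynSeparated T n ε (E : Set X) ∧ E.card = c}
  have hS0 : S.Nonempty := ⟨0, ∅, by simp [IsDynSeparated], rfl⟩
  have hSb : BddAbove S := by
    refine ⟨Fintype.card (Fin n → Fin m), ?_⟩
    rintro _ ⟨E, hE, rfl⟩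
    refine Finset.card_le_card_of_injOn (itinerary T ξ n) (fun _ _ => Finset.mem_univ _) ?_
    intro x hx y hy hxy
    by_contra hne
    obtain ⟨i, hi, hd⟩ := hE x hx y hy hne
    exact hd.not_gt (hξ _ _ (congrFun hxy ⟨i, hi⟩))
  obtain ⟨E, hE, hcard⟩ := Nat.sSup_mem hS0 hSb
  refine ⟨E, hE, fun x => ?_⟩
  by_contra! hx
  have hxE : x ∉ E := fun hxE => by
    obtain ⟨i, -, hd⟩ := hx x hxE
    rw [dist_self] at hd
    exact hd.not_gt hε
  have hsep : IsDynSeparated T n ε ((insert x E : Finset X) : Set X) := by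
    intro a ha b hb hab
    rcases Finset.mem_insert.1 ha with rfl | ha' <;> rcases Finset.mem_insert.1 hb with rfl | hb'
    · exact absurd rfl hab
    · exact hx b hb'
    · obtain ⟨i, hi, hd⟩ := hx a ha'
      exact ⟨i, hi, by rwa [dist_comm]⟩
    · exact hE a ha' b hb' hab
  have := le_csSup hSb ⟨_, hsep, rfl⟩
  rw [Finset.card_insert_of_notMem hxE, hcard] at this
  omega

end Coding

/-! ### The variational inequality -/

section Variational

variable {X : Type*} [MetricSpace X]

theorem log_sum_exp_le_of_isDynSeparated {T : X → X} {φ : X → ℝ} {ε : ℝ} {n : ℕ} {E : Finset X}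
    (hE : IsDynSeparated T n ε (E : Set X)) (hne : E.Nonempty) :
    ((Real.log (∑ x ∈ E, Real.exp (birkhoffSum T φ n x)) : ℝ) : EReal) ≤
      ENNReal.log (partitionSum T φ ε n) := by
  have hpos : 0 < ∑ x ∈ E, Real.exp (birkhoffSum T φ n x) :=
    Finset.sum_pos (fun _ _ => Real.exp_pos _) hne
  have h : ENNReal.log (ENNReal.ofReal (∑ x ∈ E, Real.exp (birkhoffSum T φ n x))) ≤
      ENNReal.log (partitionSum T φ ε n) :=
    ENNReal.log_monotone (le_iSup₂_of_le E hE le_rfl)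
  rwa [ENNReal.log_ofReal, if_neg hpos.not_ge] at h

variable [CompactSpace X] [MeasurableSpace X] [BorelSpace X]

theorem integrable_of_continuous (μ : Measure X) [IsFiniteMeasure μ] {φ : X → ℝ}
    (hφ : Continuous φ) : Integrable φ μ :=
  hφ.integrable_of_hasCompactSupport (HasCompactSupport.of_compactSpace φ)

theorem integral_birkhoffSum {μ : Measure X} [IsFiniteMeasure μ] {T : X → X}
    (hT : MeasurePreserving T μ μ) (hTc : Continuous T) {φ : X → ℝ} (hφ : Continuous φ) (n : ℕ) :
    ∫ x, birkhoffSum T φ n x ∂μ = n * ∫ x, φ x ∂μ := by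
  simp only [birkhoffSum]
  rw [integral_finsetSum (f := fun i x => φ (T^[i] x)) _ fun i _ =>
    integrable_of_continuous μ (hφ.comp (hTc.iterate i))]
  have : ∀ i, ∫ x, φ (T^[i] x) ∂μ = ∫ x, φ x ∂μ := fun i => by
    have h := hT.iterate i
    conv_rhs => rw [← h.map_eq]
    rw [integral_map h.measurable.aemeasurable]
    exact hφ.aestronglyMeasurable
  simp [this]

/-- The easy half of the variational principle. The itinerary of a partition is compared with the
map that sends a point to a nearby point of a maximal separated set: on a set of almost full measure
the partition is locally constant, and the remaining iterates contribute little entropy. -/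
theorem measurePressure_le_of_topPressure_le {T : X → X} (hTc : Continuous T) {φ : X → ℝ}
    (hφ : Continuous φ) {M : ℝ} (hM : topPressure T φ ≤ M) (μ : Measure X)
    [IsProbabilityMeasure μ] (hT : MeasurePreserving T μ μ) : measurePressure T φ μ ≤ M := by
  have : Nonempty X := nonempty_of_isProbabilityMeasure μ
  rw [measurePressure_le_coe_iff]
  intro k η hη δ hδ
  have hδ3 : 0 < δ / 3 := by positivity
  obtain ⟨δ', hδ', hres⟩ := exists_partitionEntropy_residual_lt (X := X) k hδ3
  obtain ⟨G, hGc, hGμ, r, hr, hG⟩ := exists_isCompact_locally_const μ hη hδ'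
  replace hres := hres μ η G hGc.measurableSet hGμ
  obtain ⟨w, hw, hφw⟩ := Metric.uniformContinuous_iff.1
    (CompactSpace.uniformContinuous_of_continuous hφ) (δ / 3) hδ3
  -- at scale `r / 2` points with the same centre are `r`-close; at scale `w` Birkhoff sums at a
  -- point and at its centre differ by at most `δ / 3` per unit of time
  set ε := min (r / 2) w
  have hε : 0 < ε := lt_min (by positivity) hw
  have hPε : topPressureAt T φ ε < ((M + δ / 3 : ℝ) : EReal) :=
    ((le_iSup₂ (f := fun (ε : ℝ) (_ : 0 < ε) => topPressureAt T φ ε) ε hε).trans hM).trans_lt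
      (EReal.coe_lt_coe_iff.2 (by linarith))
  filter_upwards [eventually_lt_of_limsup_lt hPε, eventually_gt_atTop 0] with n hn hn0
  have hn0' : (0 : ℝ) < n := Nat.cast_pos.2 hn0
  obtain ⟨E, hE, hspan⟩ := exists_isDynSeparated_spanning T n hε
  have hEne : E.Nonempty := by
    obtain ⟨e, he, -⟩ := hspan (Classical.arbitrary X)
    exact ⟨e, he⟩
  have : Nonempty E := hEne.to_subtype
  obtain ⟨c, hcm, hc⟩ := exists_measurable_selection
    (fun e : E => ⋂ i ∈ Finset.range n, {x | dist (T^[i] x) (T^[i] (e : X)) < ε})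
    (fun e => Finset.measurableSet_biInter _ fun i _ =>
      (isOpen_lt ((hTc.iterate i).dist continuous_const) continuous_const).measurableSet)
    (fun x => by
      obtain ⟨e, he, h⟩ := hspan x
      exact ⟨⟨e, he⟩, by simpa using h⟩)
  replace hc : ∀ x, ∀ i < n, dist (T^[i] x) (T^[i] (c x : X)) < ε := fun x => by
    simpa using hc x
  have hEnt : partitionEntropy μ (itinerary T η n) ≤
      n * partitionEntropy μ (residual η G) + partitionEntropy μ c := by
    refine partitionEntropy_itinerary_le_residual hT hη hGc.measurableSet hcm
      fun x y hxy i hi hx hy => hG _ hx _ hy ?_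
    have h1 := hc x i hi
    have h2 := hc y i hi
    rw [hxy] at h1
    rw [dist_comm] at h2
    have := min_le_left (r / 2) w
    linarith [dist_triangle (T^[i] x) (T^[i] (c y : X)) (T^[i] y)]
  have hGibbs := partitionEntropy_add_sum_mul_le μ hcm fun e : E => birkhoffSum T φ n (e : X)
  rw [Finset.sum_coe_sort E fun e => Real.exp (birkhoffSum T φ n e)] at hGibbs
  have hInt : ∫ x, birkhoffSum T φ n (c x : X) ∂μ =
      ∑ e : E, μ.real (c ⁻¹' {e}) * birkhoffSum T φ n (e : X) := by
    rw [← integral_map (φ := c) (f := fun e : E => birkhoffSum T φ n (e : X)) hcm.aemeasurable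
      (measurable_of_finite _).aestronglyMeasurable]
    have := Measure.isFiniteMeasure_map μ c
    rw [integral_fintype .of_finite]
    refine Finset.sum_congr rfl fun e _ => ?_
    rw [map_measureReal_apply hcm (measurableSet_singleton e), smul_eq_mul]
  have hcmp : n * ∫ x, φ x ∂μ ≤
      ∑ e : E, μ.real (c ⁻¹' {e}) * birkhoffSum T φ n (e : X) + n * (δ / 3) := by
    have hSint : Integrable (fun x => birkhoffSum T φ n (c x : X)) μ :=
      Integrable.comp_measurable (g := fun e : E => birkhoffSum T φ n (e : X))
        (by have := Measure.isFiniteMeasure_map μ c; exact .of_finite) hcm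
    rw [← integral_birkhoffSum hT hTc hφ, ← hInt]
    calc ∫ x, birkhoffSum T φ n x ∂μ
        ≤ ∫ x, (birkhoffSum T φ n (c x : X) + n * (δ / 3)) ∂μ := by
          refine integral_mono (integrable_of_continuous μ ?_) (hSint.add (integrable_const _))
            fun x => ?_
          · exact continuous_finsetSum _ fun i _ => hφ.comp (hTc.iterate i)
          · have : ∀ i ∈ Finset.range n, φ (T^[i] x) ≤ φ (T^[i] (c x : X)) + δ / 3 := by
              intro i hi
              have := hφw ((hc x i (Finset.mem_range.1 hi)).trans_le (min_le_right _ _))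
              rw [Real.dist_eq] at this
              linarith [le_abs_self (φ (T^[i] x) - φ (T^[i] (c x : X)))]
            simpa [birkhoffSum, Finset.sum_add_distrib] using Finset.sum_le_sum this
      _ = _ := by rw [integral_add hSint (integrable_const _)]; simp
  have hlog : Real.log (∑ e ∈ E, Real.exp (birkhoffSum T φ n e)) ≤ n * (M + δ / 3) := by
    have h1 : ((Real.log (∑ e ∈ E, Real.exp (birkhoffSum T φ n e)) / n : ℝ) : EReal) ≤
        ((M + δ / 3 : ℝ) : EReal) := by
      rw [EReal.coe_div]
      exact (EReal.div_le_div_right_of_nonneg (by positivity)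
        (log_sum_exp_le_of_isDynSeparated hE hEne)).trans hn.le
    rw [EReal.coe_le_coe_iff, div_le_iff₀ hn0'] at h1
    linarith
  have hres' := mul_le_mul_of_nonneg_left hres.le hn0'.le
  have : partitionEntropy μ (itinerary T η n) ≤ (M + δ - ∫ x, φ x ∂μ) * n := by
    linarith
  rw [← div_le_iff₀ hn0'] at this
  linarith

end Variational

/-! ### Invariant measures on the product -/

section Product

variable {X : Type*} [MetricSpace X] [CompactSpace X] [MeasurableSpace X] [BorelSpace X]

theorem measurePreserving_map_of_semiconj {Y Z : Type*} [MeasurableSpace Y] [MeasurableSpace Z]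
    {ν : Measure Y} {S : Y → Y} {T : Z → Z} {p : Y → Z} (hp : Measurable p) (hT : Measurable T)
    (hS : MeasurePreserving S ν ν) (h : p ∘ S = T ∘ p) :
    MeasurePreserving T (ν.map p) (ν.map p) := by
  refine ⟨hT, ?_⟩
  rw [Measure.map_map hT hp, ← h, ← Measure.map_map hp hS.measurable, hS.map_eq]

theorem partitionEntropy_map_itinerary {Y Z ι : Type*} [MeasurableSpace Y] [MeasurableSpace Z]
    [Fintype ι] [MeasurableSpace ι] [MeasurableSingletonClass ι]
    (ν : Measure Y) {S : Y → Y} {T : Z → Z} {p : Y → Z} (hp : Measurable p) (hT : Measurable T)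
    (h : Function.Semiconj p S T) {ξ : Z → ι} (hξ : Measurable ξ) (n : ℕ) :
    partitionEntropy ν (itinerary S (ξ ∘ p) n) =
      partitionEntropy (ν.map p) (itinerary T ξ n) := by
  rw [← partitionEntropy_comp (hp.measurePreserving ν) (measurable_itinerary hT hξ n)]
  congr 1
  funext y i
  exact congrArg ξ ((h.iterate_right i) y)

/-- The pressure of an invariant measure on the product is at most the sum of the pressures of its
marginals. -/
theorem measurePressure_prod_le {T : X → X} (hTc : Continuous T) {φ : X → ℝ} (hφ : Continuous φ)
    (ν : Measure (X × X)) [IsProbabilityMeasure ν] (hT : MeasurePreserving (Prod.map T T) ν ν)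
    {B₁ B₂ : ℝ} (h₁ : measurePressure T φ (ν.map Prod.fst) ≤ B₁)
    (h₂ : measurePressure T φ (ν.map Prod.snd) ≤ B₂) :
    measurePressure (Prod.map T T) (sumPotential φ) ν ≤ ((B₁ + B₂ : ℝ) : EReal) := by
  have : Nonempty X := (nonempty_of_isProbabilityMeasure ν).map Prod.fst
  rw [measurePressure_le_coe_iff] at *
  intro k η hη δ hδ
  have hδ3 : 0 < δ / 3 := by positivity
  obtain ⟨δ', hδ', hres⟩ := exists_partitionEntropy_residual_lt (X := X × X) k hδ3
  obtain ⟨G, hGc, hGμ, r, hr, hG⟩ := exists_isCompact_locally_const ν hη hδ'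
  replace hres := hres ν η G hGc.measurableSet hGμ
  obtain ⟨m, α, hα, hαr⟩ := exists_measurable_partition_dist_lt (X := X) hr
  have hI : ∫ z, sumPotential φ z ∂ν =
      ∫ x, φ x ∂(ν.map Prod.fst) + ∫ x, φ x ∂(ν.map Prod.snd) := by
    rw [integral_map measurable_fst.aemeasurable hφ.aestronglyMeasurable,
      integral_map measurable_snd.aemeasurable hφ.aestronglyMeasurable]
    exact integral_add (integrable_of_continuous ν (hφ.comp continuous_fst))
      (integrable_of_continuous ν (hφ.comp continuous_snd))
  filter_upwards [h₁ m α hα _ hδ3, h₂ m α hα _ hδ3, eventually_gt_atTop 0] with n hn1 hn2 hn0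
  have hn0' : (0 : ℝ) < n := Nat.cast_pos.2 hn0
  rw [← partitionEntropy_map_itinerary ν (S := Prod.map T T) measurable_fst hTc.measurable
    (fun _ => rfl) hα] at hn1
  rw [← partitionEntropy_map_itinerary ν (S := Prod.map T T) measurable_snd hTc.measurable
    (fun _ => rfl) hα] at hn2
  have hm1 := measurable_itinerary hT.measurable (hα.comp measurable_fst) n
  have hm2 := measurable_itinerary hT.measurable (hα.comp measurable_snd) n
  have hEnt := partitionEntropy_itinerary_le_residual hT hη hGc.measurableSet (hm1.prodMk hm2)
    (n := n) fun x y hxy i hi hx hy => hG _ hx _ hy (by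
      rw [Prod.dist_eq]
      exact max_lt (hαr _ _ (congrFun (Prod.ext_iff.1 hxy).1 ⟨i, hi⟩))
        (hαr _ _ (congrFun (Prod.ext_iff.1 hxy).2 ⟨i, hi⟩)))
  have hEnt := (hEnt.trans (add_le_add_right (partitionEntropy_prod_le ν hm1 hm2) _))
  have hEnt := div_le_div_of_nonneg_right hEnt hn0'.le
  rw [add_div, add_div, mul_div_cancel_left₀ _ hn0'.ne'] at hEnt
  rw [hI]
  linarith

end Product

/-! ### The non-expansive set -/

section NonExpansive

variable {X : Type*} [MetricSpace X]

theorem mem_nonExpansive_iff (f : X ≃ₜ X) {ε : ℝ} (hε : 0 < ε) (x : X) :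
    x ∈ nonExpansive f ε ↔ ∃ y, y ≠ x ∧ ∀ n : ℤ, dist ((f ^ n) x) ((f ^ n) y) ≤ ε := by
  have hx : x ∈ shadow f ε x := fun n => by simpa using hε.le
  constructor
  · intro h
    by_contra! hc
    refine h (Subset.antisymm (fun y hy => ?_) (singleton_subset_iff.2 hx))
    by_contra hne
    obtain ⟨n, hn⟩ := hc y hne
    exact hn.not_ge (hy n)
  · rintro ⟨y, hne, hy⟩ h
    have : y ∈ shadow f ε x := hy
    rw [h] at this
    exact hne this

theorem prodCongr_zpow_apply (f : X ≃ₜ X) (n : ℤ) (z : X × X) :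
    ((f.prodCongr f) ^ n) z = ((f ^ n) z.1, (f ^ n) z.2) := by
  let F : (X ≃ₜ X) →* (X × X ≃ₜ X × X) :=
    { toFun := fun g => g.prodCongr g, map_one' := rfl, map_mul' := fun _ _ => rfl }
  change ((F f) ^ n) z = _
  rw [← map_zpow]
  rfl

theorem nonExpansive_prodCongr (f : X ≃ₜ X) {ε : ℝ} (hε : 0 < ε) :
    nonExpansive (f.prodCongr f) ε =
      (univ ×ˢ nonExpansive f ε) ∪ (nonExpansive f ε ×ˢ univ) := by
  ext ⟨x, y⟩
  simp only [mem_union, mem_prod, mem_univ, true_and, and_true, mem_nonExpansive_iff _ hε,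
    prodCongr_zpow_apply, Prod.dist_eq, max_le_iff]
  constructor
  · rintro ⟨⟨x', y'⟩, hne, h⟩
    by_cases hy : y' = y
    · exact Or.inr ⟨x', fun hx => hne (Prod.ext hx hy), fun n => (h n).1⟩
    · exact Or.inl ⟨y', hy, fun n => (h n).2⟩
  · rintro (⟨y', hy, h⟩ | ⟨x', hx, h⟩)
    · exact ⟨(x, y'), fun e => hy (Prod.ext_iff.1 e).2, fun n => ⟨by simpa using hε.le, h n⟩⟩
    · exact ⟨(x', y), fun e => hx (Prod.ext_iff.1 e).1, fun n => ⟨h n, by simpa using hε.le⟩⟩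

theorem preimage_nonExpansive (f : X ≃ₜ X) {ε : ℝ} (hε : 0 < ε) :
    f ⁻¹' nonExpansive f ε = nonExpansive f ε := by
  have e : ∀ (n : ℤ) (x : X), (f ^ n) (f x) = (f ^ (n + 1)) x := fun n x => by
    rw [zpow_add_one]; rfl
  ext x
  simp only [mem_preimage, mem_nonExpansive_iff f hε]
  constructor
  · rintro ⟨y, hne, h⟩
    refine ⟨f.symm y, fun hy => hne (by rw [← hy, f.apply_symm_apply]), fun n => ?_⟩
    have := h (n - 1)
    rw [← f.apply_symm_apply y, e, e, sub_add_cancel] at this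
    exact this
  · rintro ⟨y, hne, h⟩
    refine ⟨f y, f.injective.ne hne, fun n => ?_⟩
    rw [e, e]
    exact h _

theorem iterate_zpow_apply (f : X ≃ₜ X) (i : ℕ) (n : ℤ) (x : X) :
    f^[i] ((f ^ n) x) = (f ^ (n + i)) x := by
  induction i with
  | zero => simp
  | succ i ih =>
    rw [Function.iterate_succ_apply', ih, show n + ((i + 1 : ℕ) : ℤ) = 1 + (n + i) by push_cast; ring,
      zpow_one_add]
    rfl

/-- The pairs of points at distance at least `r` that stay `ε`-close at the times in `s`. -/
def closePairs (f : X ≃ₜ X) (ε r : ℝ) (s : Set ℤ) : Set (X × X) :=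
  {z | r ≤ dist z.1 z.2 ∧ ∀ n ∈ s, dist ((f ^ n) z.1) ((f ^ n) z.2) ≤ ε}

theorem isClosed_closePairs (f : X ≃ₜ X) (ε r : ℝ) (s : Set ℤ) :
    IsClosed (closePairs f ε r s) := by
  have e : closePairs f ε r s = {z | r ≤ dist z.1 z.2} ∩
      ⋂ n ∈ s, {z | dist ((f ^ n) z.1) ((f ^ n) z.2) ≤ ε} := by
    ext z
    simp [closePairs]
  rw [e]
  exact (isClosed_le continuous_const (continuous_fst.dist continuous_snd)).inter
    (isClosed_biInter fun n _ => isClosed_le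
      (((f ^ n).continuous.comp continuous_fst).dist ((f ^ n).continuous.comp continuous_snd))
      continuous_const)

theorem nonExpansive_eq_iUnion (f : X ≃ₜ X) {ε : ℝ} (hε : 0 < ε) :
    nonExpansive f ε = ⋃ m : ℕ, Prod.fst '' closePairs f ε (1 / (m + 1)) univ := by
  ext x
  simp only [mem_nonExpansive_iff f hε, mem_iUnion, mem_image, closePairs, mem_univ,
    forall_true_left, mem_ofPred_eq, Prod.exists, exists_and_right, exists_eq_right]
  constructor
  · rintro ⟨y, hne, h⟩
    obtain ⟨m, hm⟩ := exists_nat_one_div_lt (dist_pos.2 hne.symm)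
    exact ⟨m, y, hm.le, h⟩
  · rintro ⟨m, y, hm, h⟩
    exact ⟨y, fun e => absurd hm (by rw [e, dist_self, not_le]; positivity), h⟩

variable [CompactSpace X]

theorem isClosed_fst_image_closePairs (f : X ≃ₜ X) (ε r : ℝ) (s : Set ℤ) :
    IsClosed (Prod.fst '' closePairs f ε r s) :=
  ((isClosed_closePairs f ε r s).isCompact.image continuous_fst).isClosed

theorem measurableSet_nonExpansive [MeasurableSpace X] [BorelSpace X] (f : X ≃ₜ X) {ε : ℝ}
    (hε : 0 < ε) : MeasurableSet (nonExpansive f ε) := by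
  rw [nonExpansive_eq_iUnion f hε]
  exact MeasurableSet.iUnion fun m => (isClosed_fst_image_closePairs f ε _ _).measurableSet

theorem iInter_fst_image_closePairs_subset (f : X ≃ₜ X) {ε r : ℝ} (hε : 0 < ε) (hr : 0 < r) :
    ⋂ N : ℕ, Prod.fst '' closePairs f ε r (Icc (-N : ℤ) N) ⊆ nonExpansive f ε := by
  intro x hx
  rw [mem_iInter] at hx
  let t : ℕ → Set (X × X) := fun N => closePairs f ε r (Icc (-N : ℤ) N) ∩ Prod.fst ⁻¹' {x}
  have hcl : ∀ N, IsClosed (t N) := fun N =>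
    (isClosed_closePairs f ε r _).inter (isClosed_singleton.preimage continuous_fst)
  have hanti : Antitone t := fun N N' h z hz =>
    ⟨⟨hz.1.1, fun n hn => hz.1.2 n ⟨by have := hn.1; omega, by have := hn.2; omega⟩⟩, hz.2⟩
  obtain ⟨⟨x', y⟩, hz⟩ := IsCompact.nonempty_iInter_of_directed_nonempty_isCompact_isClosed t
    (directed_of_isDirected_le hanti)
    (fun N => by
      obtain ⟨z, hz, rfl⟩ := hx N
      exact ⟨z, hz, rfl⟩)
    (fun N => (hcl N).isCompact) hcl
  rw [mem_iInter] at hz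
  obtain rfl : x' = x := (hz 0).2
  rw [mem_nonExpansive_iff f hε]
  refine ⟨y, fun e => ?_, fun n => (hz n.natAbs).1.2 n ⟨by omega, by omega⟩⟩
  have h0 : r ≤ dist x' y := (hz 0).1.1
  rw [e, dist_self] at h0
  exact h0.not_gt hr

end NonExpansive

/-! ### Measures for which almost every point is expansive -/

section Expansive

theorem measurePressure_le_of_obstructionPressureAt_le {X : Type*} [MetricSpace X]
    [MeasurableSpace X] {f : X ≃ₜ X} {φ : X → ℝ} {ε : ℝ}
    {a : EReal} (ha : obstructionPressureAt f φ ε ≤ a) {μ : Measure X}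
    (hμ : IsProbabilityMeasure μ) (hT : MeasurePreserving f μ μ)
    (h : μ (nonExpansive f ε) = 1) : measurePressure f φ μ ≤ a :=
  le_trans (le_sSup (Exists.intro μ ⟨hμ, hT, h, rfl⟩)) ha

variable {X : Type*} [MetricSpace X] [CompactSpace X] [MeasurableSpace X] [BorelSpace X]

/-- Measures that give no mass to the non-expansive set at a fixed scale have uniformly bounded
pressure. A partition of small diameter generates modulo such a measure; quantitatively, on a set of
almost full measure the label in any given partition is determined by finitely many past and future
labels in the partition of small diameter. -/
theorem exists_measurePressure_le_of_nonExpansive_null [Nonempty X] (f : X ≃ₜ X) {φ : X → ℝ}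
    (hφ : Continuous φ) {ε : ℝ} (hε : 0 < ε) :
    ∃ D : ℝ, ∀ μ : Measure X, IsProbabilityMeasure μ → MeasurePreserving f μ μ →
      μ (nonExpansive f ε) = 0 → measurePressure f φ μ ≤ D := by
  obtain ⟨m, ξ, hξ, hξε⟩ := exists_measurable_partition_dist_lt (X := X) hε
  obtain ⟨C, hC⟩ := (isCompact_range hφ).bddAbove
  have hC' : ∀ x, φ x ≤ C := fun x => hC (mem_range_self x)
  refine ⟨Real.log m + C, fun μ _ hT hμ => ?_⟩
  rw [measurePressure_le_coe_iff]
  intro k η hη δ hδ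
  have hδ2 : 0 < δ / 2 := half_pos hδ
  obtain ⟨δ', hδ', hres⟩ := exists_partitionEntropy_residual_lt (X := X) k hδ2
  obtain ⟨G, hGc, hGμ, r, hr, hG⟩ := exists_isCompact_locally_const μ hη (half_pos hδ')
  -- `b N` contains the points for which the times `-N, …, N` do not suffice to tell them from some
  -- point at distance at least `r`
  let b : ℕ → Set X := fun N => Prod.fst '' closePairs f ε r (Icc (-N : ℤ) N)
  have hb : ∀ N, MeasurableSet (b N) := fun N => (isClosed_fst_image_closePairs ..).measurableSet
  have hbanti : Antitone b := fun N N' h => image_mono fun z hz =>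
    ⟨hz.1, fun n hn => hz.2 n ⟨by have := hn.1; omega, by have := hn.2; omega⟩⟩
  obtain ⟨N, hN⟩ : ∃ N, μ.real (b N) < δ' / 2 := by
    have h0 : μ (⋂ N, b N) = 0 :=
      measure_mono_null (iInter_fst_image_closePairs_subset f hε hr) hμ
    have h1 := tendsto_measure_iInter_atTop (μ := μ) (fun N => (hb N).nullMeasurableSet) hbanti
      ⟨0, measure_ne_top _ _⟩
    rw [h0] at h1
    have h2 := (ENNReal.tendsto_toReal ENNReal.zero_ne_top).comp h1
    exact (h2.eventually (gt_mem_nhds (by simpa using half_pos hδ'))).exists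
  have hGb : MeasurableSet (G \ b N) := hGc.measurableSet.diff (hb N)
  have hGbμ : μ.real (G \ b N)ᶜ < δ' := by
    rw [sdiff_eq, compl_inter, compl_compl]
    linarith [measureReal_union_le (μ := μ) Gᶜ (b N)]
  replace hres := hres μ η _ hGb hGbμ
  have hlogm : 0 ≤ Real.log m := Real.log_natCast_nonneg m
  have hInt : ∫ x, φ x ∂μ ≤ C := by
    simpa using integral_mono (integrable_of_continuous μ hφ) (integrable_const C) hC'
  filter_upwards [eventually_ge_atTop (Nat.ceil (4 * N * Real.log m / δ)), eventually_gt_atTop 0]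
    with n hn hn0
  have hn0' : (0 : ℝ) < n := Nat.cast_pos.2 hn0
  have hcm : Measurable (itinerary f ξ (n + 2 * N) ∘ (f ^ (-N : ℤ))) :=
    (measurable_itinerary f.continuous.measurable hξ _).comp (f ^ (-N : ℤ)).continuous.measurable
  have hEnt := partitionEntropy_itinerary_le_residual hT hη hGb hcm (n := n)
    fun x y hxy i hi hx hy => hG _ hx.1 _ hy.1 (by
      by_contra! hd
      refine hx.2 ⟨(f^[i] x, f^[i] y), ⟨hd, fun j hj => ?_⟩, rfl⟩
      -- time `j` relative to time `i` is entry `i + j + N` of an itinerary started at time `-N`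
      have hl := congrFun hxy ⟨(i + j + N).toNat, by have := hj.1; have := hj.2; omega⟩
      have hd := (hξε _ _ hl).le
      have hij : -(N : ℤ) + ((i + j + N).toNat : ℤ) = j + i := by have := hj.1; omega
      have e : ∀ x : X, (f ^ j) (f^[i] x) = (f ^ (j + i)) x := fun x => by
        rw [zpow_add, show f^[i] x = (f ^ (i : ℤ)) x by simpa using iterate_zpow_apply f i 0 x]
        rfl
      simp only [iterate_zpow_apply, hij] at hd
      simpa only [e] using hd)
  have hcard := partitionEntropy_le_log_card μ hcm
  rw [Fintype.card_fun, Fintype.card_fin, Fintype.card_fin, Nat.cast_pow, Real.log_pow] at hcard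
  push_cast at hcard
  have hn' : 4 * N * Real.log m ≤ n * δ := by
    have := Nat.ceil_le.1 hn
    rwa [div_le_iff₀ hδ] at this
  have hres' := mul_le_mul_of_nonneg_left hres.le hn0'.le
  have : partitionEntropy μ (itinerary f η n) ≤ (Real.log m + δ) * n := by
    linarith
  rw [← div_le_iff₀ hn0'] at this
  linarith

/-- If the obstruction pressure is finite at one scale, then the pressures of all invariant
measures are bounded: split a measure along the non-expansive set. -/
theorem exists_measurePressure_le [Nonempty X] (f : X ≃ₜ X) {φ : X → ℝ} (hφ : Continuous φ)
    {ε : ℝ} (hε : 0 < ε) {a : ℝ} (ha : obstructionPressureAt f φ ε ≤ a) :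
    ∃ M : ℝ, ∀ μ : Measure X, IsProbabilityMeasure μ → MeasurePreserving f μ μ →
      measurePressure f φ μ ≤ M := by
  obtain ⟨D, hD⟩ := exists_measurePressure_le_of_nonExpansive_null f hφ hε
  have hA := measurableSet_nonExpansive f hε
  have hinv := preimage_nonExpansive f hε
  refine ⟨max a D, fun μ _ hT => measurePressure_le_of_cond hT.measurable
    (integrable_of_continuous μ hφ) hA (fun h => ?_) fun h => ?_⟩
  · exact (measurePressure_le_of_obstructionPressureAt_le ha
      (ProbabilityTheory.cond_isProbabilityMeasure h) (measurePreserving_cond hT hA hinv)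
      (ProbabilityTheory.cond_apply_self h (measure_ne_top _ _))).trans
      (EReal.coe_le_coe_iff.2 (le_max_left _ _))
  · refine (hD _ (ProbabilityTheory.cond_isProbabilityMeasure h)
      (measurePreserving_cond hT hA.compl (by rw [preimage_compl, hinv])) ?_).trans
      (EReal.coe_le_coe_iff.2 (le_max_right _ _))
    rw [ProbabilityTheory.cond_apply hA.compl, compl_inter_self, measure_empty, mul_zero]

/-- The obstruction pressure of the product at scale `ε`: invariant measures carried by
`NE(ε) × X` or `X × NE(ε)` have a marginal carried by `NE(ε)`. -/
theorem obstructionPressureAt_prodCongr_le (f : X ≃ₜ X) {φ : X → ℝ} (hφ : Continuous φ)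
    {ε : ℝ} (hε : 0 < ε) {a M : ℝ} (ha : obstructionPressureAt f φ ε ≤ a)
    (hM : ∀ μ : Measure X, IsProbabilityMeasure μ → MeasurePreserving f μ μ →
      measurePressure f φ μ ≤ M) :
    obstructionPressureAt (f.prodCongr f) (sumPotential φ) ε ≤ ((M + a : ℝ) : EReal) := by
  refine sSup_le ?_
  rintro _ ⟨ν, _, hT, hν, rfl⟩
  have hA := measurableSet_nonExpansive f hε
  have hinv := preimage_nonExpansive f hε
  have hfm : Measurable f := f.continuous.measurable
  have hf1 : ∀ {ρ : Measure (X × X)}, MeasurePreserving (f.prodCongr f) ρ ρ →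
      MeasurePreserving f (ρ.map Prod.fst) (ρ.map Prod.fst) := fun h =>
    measurePreserving_map_of_semiconj measurable_fst hfm h rfl
  have hf2 : ∀ {ρ : Measure (X × X)}, MeasurePreserving (f.prodCongr f) ρ ρ →
      MeasurePreserving f (ρ.map Prod.snd) (ρ.map Prod.snd) := fun h =>
    measurePreserving_map_of_semiconj measurable_snd hfm h rfl
  have hS1 : MeasurableSet (Prod.fst ⁻¹' nonExpansive f ε : Set (X × X)) := measurable_fst hA
  have hinv1 : (f.prodCongr f) ⁻¹' (Prod.fst ⁻¹' nonExpansive f ε : Set (X × X)) =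
      Prod.fst ⁻¹' nonExpansive f ε := by
    conv_rhs => rw [← hinv]
    rfl
  have hint : Integrable (sumPotential φ) ν := integrable_of_continuous ν
    ((hφ.comp continuous_fst).add (hφ.comp continuous_snd))
  refine measurePressure_le_of_cond hT.measurable hint hS1 (fun h => ?_) fun h => ?_
  · have := ProbabilityTheory.cond_isProbabilityMeasure h
    have hTc := measurePreserving_cond hT hS1 hinv1
    rw [add_comm]
    refine measurePressure_prod_le f.continuous hφ _ hTc
      (measurePressure_le_of_obstructionPressureAt_le ha
        (Measure.isProbabilityMeasure_map measurable_fst.aemeasurable) (hf1 hTc) ?_)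
      (hM _ (Measure.isProbabilityMeasure_map measurable_snd.aemeasurable) (hf2 hTc))
    rw [Measure.map_apply measurable_fst hA]
    exact ProbabilityTheory.cond_apply_self h (measure_ne_top _ _)
  · have := ProbabilityTheory.cond_isProbabilityMeasure h
    have hTc := measurePreserving_cond hT hS1.compl (by rw [preimage_compl, hinv1])
    refine measurePressure_prod_le f.continuous hφ _ hTc
      (hM _ (Measure.isProbabilityMeasure_map measurable_fst.aemeasurable) (hf1 hTc))
      (measurePressure_le_of_obstructionPressureAt_le ha
        (Measure.isProbabilityMeasure_map measurable_snd.aemeasurable) (hf2 hTc) ?_)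
    rw [Measure.map_apply measurable_snd hA, ← prob_compl_eq_zero_iff (measurable_snd hA),
      ProbabilityTheory.cond_apply hS1.compl]
    refine mul_eq_zero_of_right _ (measure_mono_null (t := (nonExpansive (f.prodCongr f) ε)ᶜ) ?_ ?_)
    · rw [nonExpansive_prodCongr f hε]
      rintro z ⟨h1, h2⟩ (h3 | h3)
      · exact h2 h3.2
      · exact h1 h3.1
    · exact (prob_compl_eq_zero_iff (measurableSet_nonExpansive _ hε)).2 hν

end Expansive

/-! ### Topological pressure of the product -/

section TopProduct

variable {X : Type*} [MetricSpace X]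

theorem prodCongr_iterate_apply (f : X ≃ₜ X) (n : ℕ) (z : X × X) :
    (f.prodCongr f)^[n] z = (f^[n] z.1, f^[n] z.2) := by
  change (Prod.map f f)^[n] z = _
  rw [Prod.map_iterate]
  rfl

/-- Products of separated sets are separated, so the partition sums are supermultiplicative. -/
theorem partitionSum_mul_self_le (f : X ≃ₜ X) (φ : X → ℝ) (ε : ℝ) (n : ℕ) {E : Finset X}
    (hE : IsDynSeparated f n ε (E : Set X)) :
    ENNReal.ofReal (∑ x ∈ E, Real.exp (birkhoffSum f φ n x)) *
        ENNReal.ofReal (∑ x ∈ E, Real.exp (birkhoffSum f φ n x)) ≤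
      partitionSum (f.prodCongr f) (sumPotential φ) ε n := by
  rw [← ENNReal.ofReal_mul (Finset.sum_nonneg fun _ _ => (Real.exp_pos _).le)]
  refine le_iSup₂_of_le (E ×ˢ E) ?_ (le_of_eq ?_)
  · rintro ⟨x, y⟩ hz ⟨x', y'⟩ hz' hne
    simp only [Finset.coe_product, mem_prod] at hz hz'
    simp only [prodCongr_iterate_apply, Prod.dist_eq, le_max_iff]
    by_cases hx : x = x'
    · obtain ⟨i, hi, h⟩ := hE y hz.2 y' hz'.2 fun hy => hne (Prod.ext hx hy)
      exact ⟨i, hi, Or.inr h⟩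
    · obtain ⟨i, hi, h⟩ := hE x hz.1 x' hz'.1 hx
      exact ⟨i, hi, Or.inl h⟩
  · rw [Finset.sum_mul_sum, Finset.sum_product]
    congr 1
    refine Finset.sum_congr rfl fun x _ => Finset.sum_congr rfl fun y _ => ?_
    rw [← Real.exp_add, birkhoffSum, birkhoffSum, birkhoffSum, ← Finset.sum_add_distrib]
    simp [sumPotential]

theorem add_self_le_topPressure_prodCongr (f : X ≃ₜ X) (φ : X → ℝ) {c : ℝ}
    (hc : (c : EReal) < topPressure f φ) :
    ((c + c : ℝ) : EReal) ≤ topPressure (f.prodCongr f) (sumPotential φ) := by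
  obtain ⟨ε, hε, h⟩ : ∃ ε : ℝ, ∃ _ : 0 < ε, (c : EReal) < topPressureAt f φ ε := by
    simpa only [topPressure, lt_iSup_iff] using hc
  refine le_trans ?_ (le_iSup₂ (f := fun (ε : ℝ) (_ : 0 < ε) =>
    topPressureAt (f.prodCongr f) (sumPotential φ) ε) ε hε)
  refine le_limsup_of_frequently_le
    (((frequently_lt_of_lt_limsup (by isBoundedDefault) h).and_eventually
      (eventually_gt_atTop 0)).mono ?_)
  rintro n ⟨hn, hn0⟩
  have hn0' : (0 : EReal) < n := by exact_mod_cast hn0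
  have hnt : (n : EReal) ≠ ⊤ := EReal.natCast_ne_top n
  rw [EReal.lt_div_iff hn0' hnt] at hn
  rw [EReal.le_div_iff_mul_le hn0' hnt]
  have hcn : (c : EReal) * n = ((c * n : ℝ) : EReal) := by push_cast; rfl
  have hcn2 : ((c + c : ℝ) : EReal) * n = ((c * n : ℝ) : EReal) + ((c * n : ℝ) : EReal) := by
    rw [← EReal.coe_add, ← add_mul]; push_cast; rfl
  have hexp : ENNReal.ofReal (Real.exp (c * n)) < partitionSum f φ ε n := by
    rw [← ENNReal.log_lt_log_iff, ENNReal.log_ofReal, if_neg (Real.exp_pos _).not_ge,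
      Real.log_exp, ← hcn]
    exact hn
  obtain ⟨E, hE, hlt⟩ : ∃ E : Finset X, ∃ _ : IsDynSeparated f n ε (E : Set X),
      ENNReal.ofReal (Real.exp (c * n)) <
        ENNReal.ofReal (∑ x ∈ E, Real.exp (birkhoffSum f φ n x)) := by
    simpa only [partitionSum, lt_iSup_iff] using hexp
  refine le_trans ?_ (ENNReal.log_monotone (partitionSum_mul_self_le f φ ε n hE))
  refine le_trans ?_ (ENNReal.log_monotone (mul_le_mul' hlt.le hlt.le))
  rw [ENNReal.log_mul_add, ENNReal.log_ofReal, if_neg (Real.exp_pos _).not_ge, Real.log_exp, hcn2]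

theorem topPressure_eq_bot_of_isEmpty [IsEmpty X] (T : X → X) (φ : X → ℝ) :
    topPressure T φ = ⊥ := by
  refine le_bot_iff.1 (iSup₂_le fun ε _ => ?_)
  refine limsup_le_of_le (h := ?_)
  filter_upwards [eventually_gt_atTop 0] with n hn
  have : partitionSum T φ ε n = 0 := by
    simp [partitionSum, Finset.eq_empty_of_isEmpty]
  rw [this, ENNReal.log_zero, EReal.bot_div_of_pos_ne_top (by exact_mod_cast hn)
    (EReal.natCast_ne_top n)]

end TopProduct

end PressureGap

theorem mainTheorem10 {X : Type*} [MetricSpace X] [CompactSpace X] [MeasurableSpace X]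
    [BorelSpace X] (f : X ≃ₜ X) (φ : X → ℝ) (hφ : Continuous φ) :
    (∀ ε : ℝ, 0 < ε →
      PressureGap.nonExpansive (f.prodCongr f) ε =
        (univ ×ˢ PressureGap.nonExpansive f ε) ∪ (PressureGap.nonExpansive f ε ×ˢ univ)) ∧
    (PressureGap.obstructionPressure f φ < PressureGap.topPressure f φ →
      PressureGap.obstructionPressure (f.prodCongr f) (PressureGap.sumPotential φ) <
        PressureGap.topPressure (f.prodCongr f) (PressureGap.sumPotential φ)) := by
  refine ⟨fun ε hε => PressureGap.nonExpansive_prodCongr f hε, fun hgap => ?_⟩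
  have hX : Nonempty X := by
    by_contra hX
    rw [not_nonempty_iff] at hX
    rw [PressureGap.topPressure_eq_bot_of_isEmpty] at hgap
    exact not_lt_bot hgap
  obtain ⟨a, ha, haP⟩ := EReal.lt_iff_exists_real_btwn.1 hgap
  obtain ⟨ε, hε, haε⟩ : ∃ ε : ℝ, ∃ _ : 0 < ε, PressureGap.obstructionPressureAt f φ ε < a := by
    simpa only [PressureGap.obstructionPressure, iInf_lt_iff] using ha
  -- `M` bounds the pressure of every invariant measure, and `c` is such that `M + a < 2c`; when
  -- the topological pressure is infinite the variational inequality gives no finite `M`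
  obtain ⟨M, c, hM, hc, hlt⟩ : ∃ M c : ℝ, (∀ μ : Measure X, IsProbabilityMeasure μ →
      MeasurePreserving f μ μ → PressureGap.measurePressure f φ μ ≤ M) ∧
      (c : EReal) < PressureGap.topPressure f φ ∧ M + a < c + c := by
    by_cases htop : PressureGap.topPressure f φ = ⊤
    · obtain ⟨M, hM⟩ := PressureGap.exists_measurePressure_le f hφ hε haε.le
      exact ⟨M, (M + a + 1) / 2, hM, htop ▸ EReal.coe_lt_top _, by linarith⟩
    · have hP := EReal.coe_toReal htop (bot_le.trans_lt haP).ne'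
      set p := (PressureGap.topPressure f φ).toReal
      rw [← hP, EReal.coe_lt_coe_iff] at haP
      refine ⟨p, (3 * p + a) / 4, fun μ _ hT =>
        PressureGap.measurePressure_le_of_topPressure_le f.continuous hφ hP.ge μ hT, ?_, ?_⟩
      · rw [← hP, EReal.coe_lt_coe_iff]
        linarith
      · linarith
  calc PressureGap.obstructionPressure (f.prodCongr f) (PressureGap.sumPotential φ)
      ≤ PressureGap.obstructionPressureAt (f.prodCongr f) (PressureGap.sumPotential φ) ε :=
        iInf₂_le ε hε
    _ ≤ ((M + a : ℝ) : EReal) :=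
        PressureGap.obstructionPressureAt_prodCongr_le f hφ hε haε.le hM
    _ < ((c + c : ℝ) : EReal) := EReal.coe_lt_coe_iff.2 hlt
    _ ≤ _ := PressureGap.add_self_le_topPressure_prodCongr f φ hc
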